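/- Let $d,n,m\ge 1$, let $\Omega\subset\mathbb R^d$ be a bounded open set, let $\square=[0,1)^d$, and let $T$ be $\square$ with the topology of the $d$-dimensional torus. Write $|A|$ for Lebesgue measure and $\langle\cdot\rangle$ for the componentwise fractional part. Let $\rho_1,\dots,\rho_n$ be positive functions of $\varepsilon>0$ with $\rho_k(\varepsilon)\to0$ as $\varepsilon\to0^+$ for all $k$ and $\rho_{k+1}(\varepsilon)/\rho_k(\varepsilon)\to0$ as $\varepsilon\to0^+$ for $1\le k\le n-1$. Fix a sequence $\varepsilon_h>0$ with $\varepsilon_h\to0$. For a locally compact, complete, separable metric space $S$ and a bounded measurable subset $D$ of a Euclidean space, let $\mathcal Y(D,S)$ be the family of maps $x\mapsto\mu_x$ from $D$ to the Borel measures on $S$ such that $\mu_x$ is a probability measure for a.e. $x\in D$ and $x\mapsto\int_S\phi\,d\mu_x$ is measurable for every $\phi\in C_0(S)$. Measurable maps $w_h:D\to S$ generate the Young measure $\mu\in\mathcal Y(D,S)$ if $\int_D\varphi_x(w_h(x))\,dx\to\int_D\int_S\varphi_x\,d\mu_x\,dx$ for every $\varphi\in L^1(D,C_0(S))$. For measurable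 $u_h:\Omega\to\mathbb R^m$ put $$w_h(x)=\Bigl(\Bigl\langle\frac{x}{\rho_1(\varepsilon_h)}\Bigr\rangle,\dots,\Bigl\langle\frac{x}{\rho_n(\varepsilon_h)}\Bigr\rangle,u_h(x)\Bigr).$$ The sequence $u_h$ generates the multiscale Young measure $\nu\in\mathcal Y(\Omega\times\square^n,\mathbb R^m)$ if $w_h$ generates a Young measure $\mu\in\mathcal Y(\Omega,T^n\times\mathbb R^m)$ and, for every Borel set $A\subseteq\Omega\times T^n\times\mathbb R^m$, $$\int_\Omega\mu_x\bigl(\{(y,z):(x,y,z)\in A\}\bigr)\,dx=\int_{\Omega\times\square^n}\nu_{(x,y)}\bigl(\{z:(x,y,z)\in A\}\bigr)\,dx\,dy .$$ A function $f:\Omega\times\square^n\times\mathbb R^m\to[0,+\infty)$ is an admissible integrand if for every $\delta>0$ there are compact sets $X\subseteq\Omega$ and $Y\subseteq\square$ with $|\Omega\setminus X|\le\delta$ and $|\square\setminus Y|\le\delta$ such that the restriction of $f$ to $X\times Y^n\times\mathbb R^m$ is continuous. **Theorem.** Let $q\in[1,+\infty)$, let $u_h$ be a bounded sequence in $L^q(\Omega,\mathbb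 R^m)$ generating a multiscale Young measure $\nu$, and let $f:\Omega\times\square^n\times\mathbb R^m\to[0,+\infty)$ be an admissible integrand such that, for some $c>0$, $f(x,y,z)\le c(1+|z|^q)$ for all $(x,y,z)\in\Omega\times\square^n\times\mathbb R^m$. Put $$\overline f(x,y):=\int_{\mathbb R^m}f(x,y,z)\,d\nu_{(x,y)}(z).$$ Then the functions $x\mapsto f(x,w_h(x))$ on $\Omega$ and $\overline f$ on $\Omega\times\square^n$ are Lebesgue measurable, and $$\liminf_{h\to+\infty}\int_\Omega f\bigl(x,w_h(x)\bigr)\,dx\;\ge\;\int_{\Omega\times\square^n}\overline f(x,y)\,dx\,dy .$$ -/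

import Mathlib

open MeasureTheory Filter Set
open scoped Topology ENNReal ZeroAtInfty

noncomputable section

namespace MultiscaleYoung

/-! ### Young measures

In this section `D` is a measurable subset of a measure space `E` (a Euclidean space, or a product
of such, with Lebesgue measure), and `S` is a locally compact, complete, separable metric space
with its Borel sigma-algebra. All notions depend only on the values almost everywhere in `D`. -/

/-- The class `𝒴(D, S)`: weak* measurable maps `x ↦ μ x` from `D` to the measures on `S` such that
`μ x` is a probability measure for a.e. `x ∈ D`. Weak* measurability means that
`x ↦ ∫ φ dμ_x` is (Lebesgue) measurable on `D` for all `φ ∈ C₀(S)`. -/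
def IsParametrizedProb {E S : Type*} [MeasureSpace E] [TopologicalSpace S] [MeasurableSpace S]
    (D : Set E) (μ : E → Measure S) : Prop :=
  (∀ φ : C₀(S, ℝ), AEMeasurable (fun x => ∫ s, φ s ∂(μ x)) (volume.restrict D)) ∧
    ∀ᵐ x ∂(volume.restrict D), IsProbabilityMeasure (μ x)

/-- `μ ∈ 𝒴(D, S)` is the Young measure generated by the sequence `w h : D → S`: the Dirac masses
`δ_{w h}` converge to `μ` in the weak* topology given by the duality with `L¹(D, C₀(S))`. -/
def GeneratesYoungMeasure {E S : Type*} [MeasureSpace E] [TopologicalSpace S] [MeasurableSpace S]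
    (D : Set E) (w : ℕ → E → S) (μ : E → Measure S) : Prop :=
  IsParametrizedProb D μ ∧
    ∀ φ : E → C₀(S, ℝ), Integrable φ (volume.restrict D) →
      Tendsto (fun h => ∫ x in D, φ x (w h x)) atTop (𝓝 (∫ x in D, ∫ s, φ x s ∂(μ x)))

/-- The value on the set `A ⊆ D × S` of the measure `μ̂` on `D × S` associated with `μ ∈ 𝒴(D, S)`:
`μ̂(A) = ∫_D μ_x {s | (x, s) ∈ A} dx`. -/
def hat {E S : Type*} [MeasureSpace E] [MeasurableSpace S]
    (D : Set E) (μ : E → Measure S) (A : Set (E × S)) : ℝ≥0∞ :=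
  ∫⁻ x in D, μ x {s | (x, s) ∈ A}

/-! ### Multiscale Young measures -/

/-- The unit cell `□ = [0, 1)^d`. -/
def cell (d : ℕ) : Set (EuclideanSpace ℝ (Fin d)) :=
  {y | ∀ i, y i ∈ Ico (0 : ℝ) 1}

/-- `□ⁿ`. -/
def cellPow (n d : ℕ) : Set (Fin n → EuclideanSpace ℝ (Fin d)) :=
  {y | ∀ k, y k ∈ cell d}

/-- The componentwise fractional part `⟨x⟩`. -/
def fracPart {d : ℕ} (x : EuclideanSpace ℝ (Fin d)) : EuclideanSpace ℝ (Fin d) :=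
  WithLp.toLp 2 (fun i => Int.fract (x i))

/-- `(⟨x / r₁⟩, …, ⟨x / rₙ⟩) ∈ □ⁿ`. -/
def microVars {n d : ℕ} (r : Fin n → ℝ) (x : EuclideanSpace ℝ (Fin d)) :
    Fin n → EuclideanSpace ℝ (Fin d) :=
  fun k => fracPart ((r k)⁻¹ • x)

/-- The canonical map to `Tⁿ`, where `T` is the `d`-dimensional torus; on `□ⁿ` it is the bijection
that identifies `□ⁿ` with `Tⁿ`. -/
def toTorus {n d : ℕ} (y : Fin n → EuclideanSpace ℝ (Fin d)) : Fin n → UnitAddTorus (Fin d) :=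
  fun k i => ((y k i : ℝ) : UnitAddCircle)

/-- The length scales `ρ₁, …, ρₙ`: positive functions of `ε > 0`, infinitesimal as `ε → 0⁺`,
with `ρ_{k+1} / ρ_k → 0`. -/
def SeparatedScales {n : ℕ} (ρ : Fin n → ℝ → ℝ) : Prop :=
  (∀ k, ∀ ε, 0 < ε → 0 < ρ k ε) ∧
  (∀ k, Tendsto (ρ k) (𝓝[>] 0) (𝓝 0)) ∧
  (∀ k l : Fin n, (l : ℕ) = (k : ℕ) + 1 → Tendsto (fun ε => ρ l ε / ρ k ε) (𝓝[>] 0) (𝓝 0))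

/-- `ν ∈ 𝒴(Ω × □ⁿ, ℝᵐ)` is the multiscale Young measure generated by `u h` (along the scales
`r k h`): the sequence `w_h = (⟨x / r₁ h⟩, …, ⟨x / rₙ h⟩, u_h)`, with values in `Tⁿ × ℝᵐ`, generates
a Young measure `μ ∈ 𝒴(Ω, Tⁿ × ℝᵐ)` and `ν` is its disintegration over `Ω × □ⁿ`, that is,
`μ̂ = ν̂` as Borel measures on `Ω × Tⁿ × ℝᵐ`, with `□ⁿ` identified with `Tⁿ`. -/
def GeneratesMultiscaleYoungMeasure {n d m : ℕ} (Ω : Set (EuclideanSpace ℝ (Fin d)))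
    (r : Fin n → ℕ → ℝ) (u : ℕ → EuclideanSpace ℝ (Fin d) → EuclideanSpace ℝ (Fin m))
    (ν : EuclideanSpace ℝ (Fin d) × (Fin n → EuclideanSpace ℝ (Fin d)) →
      Measure (EuclideanSpace ℝ (Fin m))) : Prop :=
  IsParametrizedProb (Ω ×ˢ cellPow n d) ν ∧
  ∃ μ : EuclideanSpace ℝ (Fin d) →
      Measure ((Fin n → UnitAddTorus (Fin d)) × EuclideanSpace ℝ (Fin m)),
    GeneratesYoungMeasure Ω
      (fun h x => (toTorus (microVars (fun k => r k h) x), u h x)) μ ∧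
    ∀ A : Set (EuclideanSpace ℝ (Fin d) ×
        ((Fin n → UnitAddTorus (Fin d)) × EuclideanSpace ℝ (Fin m))),
      MeasurableSet A →
        hat Ω μ A = hat (Ω ×ˢ cellPow n d) ν {p | (p.1.1, (toTorus p.1.2, p.2)) ∈ A}

/-! ### Admissible integrands -/

/-- `f : Ω × □ⁿ × ℝᵐ → [0, ∞)` is an admissible integrand. -/
def IsAdmissibleIntegrand {n d m : ℕ} (Ω : Set (EuclideanSpace ℝ (Fin d)))
    (f : EuclideanSpace ℝ (Fin d) → (Fin n → EuclideanSpace ℝ (Fin d)) →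
      EuclideanSpace ℝ (Fin m) → ℝ) : Prop :=
  (∀ x ∈ Ω, ∀ y ∈ cellPow n d, ∀ z, 0 ≤ f x y z) ∧
  ∀ δ : ℝ, 0 < δ → ∃ (X : Set (EuclideanSpace ℝ (Fin d))) (Y : Set (EuclideanSpace ℝ (Fin d))),
    IsCompact X ∧ X ⊆ Ω ∧ volume (Ω \ X) ≤ ENNReal.ofReal δ ∧
    IsCompact Y ∧ Y ⊆ cell d ∧ volume (cell d \ Y) ≤ ENNReal.ofReal δ ∧
    ContinuousOn
      (fun p : EuclideanSpace ℝ (Fin d) × (Fin n → EuclideanSpace ℝ (Fin d)) ×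
        EuclideanSpace ℝ (Fin m) => f p.1 p.2.1 p.2.2)
      (X ×ˢ ({y | ∀ k, y k ∈ Y} ×ˢ univ))

end MultiscaleYoung

end

namespace MultiscaleYoung

/-! ### Weak* measurable families of probability measures are a.e. equal to kernels -/

/-! The inequality is weak* convergence tested against truncations of `f`. Only `≥` is to be
expected: mass of `f` may escape to infinity in `z`, and positivity of `f` allows it to be
discarded.

Fix a ball of radius `R` and `δ > 0`, and take compact `X`, `Y` with `f` continuous on `X × Yⁿ ×
ℝᵐ`. Since `Y` is compact inside the half-open cell, `Yⁿ` embeds as a closed subset of the torus.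
Tietze extension and a cutoff in `z` then give a continuous `G` with values in `[0, M]` that lies
below `f` on the good set and equals it for `|z| ≤ R` (`exists_truncated_extension`). The Young
measure gives the limit of the integrals of `G`, and `lintegral_eq_of_hat_eq` rewrites it in terms
of `ν`.

Off the good set one pays at most `M` times a measure of order `δ`. In `Ω × □ⁿ` this is a product
estimate; along the sequence it must be uniform in `h`, which follows by counting the cells of side
`r` that meet `Ω` (`exists_volume_fracPart_le`). Let `δ → 0`, then `R → ∞` by monotone convergence.

Measurability has two sources: a weak* measurable family is a.e. a kernel, and `f` agrees with a
Borel function on a set that is of full measure both in the product and along the oscillating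
variables. -/

lemma aemeasurable_measure_of_isCompact {E S : Type*} [MeasureSpace E] [TopologicalSpace S]
    [TopologicalSpace.MetrizableSpace S] [LocallyCompactSpace S]
    [MeasurableSpace S] [BorelSpace S] {D : Set E} {μ : E → Measure S}
    (hμ : IsParametrizedProb D μ) {K : Set S} (hK : IsCompact K) :
    AEMeasurable (fun x => μ x K) (volume.restrict D) := by
  let := TopologicalSpace.metrizableSpaceMetric S
  obtain ⟨g, hgK, -, hg, h01⟩ := exists_continuous_one_zero_of_isCompact_of_isGδ hK
    hK.isClosed.isGδ isClosed_empty (disjoint_empty K)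
  -- A compact set is a `Gδ` here, so `g = 1` exactly on `K` and the powers of `g` decrease to the
  -- indicator of `K`. The exponent `j + 1` excludes the power zero, which would destroy compact
  -- support.
  let φ : ℕ → C₀(S, ℝ) := fun j =>
    ⟨⟨fun s => g s ^ (j + 1), by fun_prop⟩, by
      refine HasCompactSupport.is_zero_at_infty (f := fun s => g s ^ (j + 1)) ?_
      exact hg.comp_left (g := fun t : ℝ => t ^ (j + 1)) (by simp)⟩
  have hreal : AEMeasurable (fun x => (μ x K).toReal) (volume.restrict D) := by
    refine aemeasurable_of_tendsto_metrizable_ae (u := atTop)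
      (f := fun j x => ∫ s, φ j s ∂(μ x)) (fun j => hμ.1 (φ j)) ?_
    filter_upwards [hμ.2] with x hx
    have hint : (μ x K).toReal = ∫ s, K.indicator (fun _ => (1 : ℝ)) s ∂(μ x) := by
      rw [integral_indicator hK.measurableSet]
      simp [Measure.real]
    rw [hint]
    refine tendsto_integral_of_dominated_convergence (fun _ => 1)
      (fun j => (φ j).continuous.aestronglyMeasurable) (integrable_const _)
      (fun j => Eventually.of_forall fun s => ?_) (Eventually.of_forall fun s => ?_)
    · change ‖g s ^ (j + 1)‖ ≤ 1
      rw [norm_pow, Real.norm_of_nonneg (h01 s).1]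
      exact pow_le_one₀ (h01 s).1 (h01 s).2
    · change Tendsto (fun j => g s ^ (j + 1)) atTop _
      by_cases hs : s ∈ K
      · have h1 : g s = 1 := by rw [hgK] at hs; exact hs
        simp [hs, h1]
      · have h1 : g s < 1 := lt_of_le_of_ne (h01 s).2 fun h => hs (by rw [hgK]; exact h)
        simp only [hs, not_false_eq_true, indicator_of_notMem]
        exact (tendsto_pow_atTop_nhds_zero_of_lt_one (h01 s).1 h1).comp (tendsto_add_atTop_nat 1)
  refine hreal.ennreal_ofReal.congr ?_
  filter_upwards [hμ.2] with x hx
  exact ENNReal.ofReal_toReal (measure_ne_top _ _)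

/-- A countable family of compact sets that generates the Borel sigma-algebra. -/
lemma exists_countable_compact_generateFrom (S : Type*) [TopologicalSpace S] [T2Space S]
    [LocallyCompactSpace S] [SecondCountableTopology S] [mS : MeasurableSpace S] [BorelSpace S] :
    ∃ (ι : Type) (_ : Countable ι) (K : ι → Set S), (∀ i, IsCompact (K i)) ∧
      mS = MeasurableSpace.generateFrom (range fun F : Finset ι => ⋂ i ∈ F, K i) := by
  classical
  obtain ⟨e, he⟩ : ∃ e : ℕ → Set S, TopologicalSpace.IsTopologicalBasis (insert ∅ (range e)) := by
    obtain ⟨b, hbc, -, hb⟩ := TopologicalSpace.exists_countable_basis S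
    obtain ⟨e, he⟩ := (hbc.insert ∅).exists_eq_range (insert_nonempty _ _)
    refine ⟨e, ?_⟩
    rw [← he, insert_eq_of_mem (mem_insert _ _)]
    exact hb.insert_empty
  -- Noncompact closures can be dropped: by local compactness every open set is the union of the
  -- compact closures of basic sets contained in it.
  refine ⟨ℕ, inferInstance, fun i => if IsCompact (closure (e i)) then closure (e i) else ∅, ?_, ?_⟩
  · intro i
    dsimp only
    split_ifs with h
    exacts [h, isCompact_empty]
  set K : ℕ → Set S := fun i => if IsCompact (closure (e i)) then closure (e i) else ∅ with hKdef
  have hKc : ∀ i, IsCompact (K i) := by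
    intro i
    simp only [hKdef]
    split_ifs with h
    exacts [h, isCompact_empty]
  have hKm : ∀ i, MeasurableSet[MeasurableSpace.generateFrom
      (range fun F : Finset ℕ => ⋂ i ∈ F, K i)] (K i) := fun i =>
    MeasurableSpace.measurableSet_generateFrom ⟨{i}, by simp⟩
  refine le_antisymm ?_ ?_
  · rw [BorelSpace.measurable_eq (α := S), borel]
    refine MeasurableSpace.generateFrom_le fun U hU => ?_
    have hU' : U = ⋃ i ∈ {i | K i ⊆ U}, K i := by
      refine subset_antisymm (fun x hx => ?_) (iUnion₂_subset fun i hi => hi)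
      obtain ⟨L, hLc, hxL, hLU⟩ := exists_compact_subset hU hx
      obtain ⟨b, hb, hxb, hbL⟩ := he.exists_subset_of_mem_open hxL isOpen_interior
      obtain rfl | ⟨i, rfl⟩ := hb
      · exact hxb.elim
      have hcl : closure (e i) ⊆ L :=
        closure_minimal (hbL.trans interior_subset) hLc.isClosed
      have hKi : K i = closure (e i) := if_pos (hLc.of_isClosed_subset isClosed_closure hcl)
      refine mem_biUnion (x := i) ?_ ?_
      · change K i ⊆ U
        rw [hKi]; exact hcl.trans hLU
      · rw [hKi]; exact subset_closure hxb
    rw [hU']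
    exact MeasurableSet.biUnion (to_countable _) fun i _ => hKm i
  · refine MeasurableSpace.generateFrom_le ?_
    rintro _ ⟨F, rfl⟩
    exact Finset.measurableSet_biInter F fun i _ => (hKc i).measurableSet

/-- A weak* measurable family of probability measures coincides almost everywhere with a finite
kernel. -/
theorem IsParametrizedProb.exists_kernel {E S : Type*} [MeasureSpace E] [TopologicalSpace S]
    [TopologicalSpace.MetrizableSpace S] [LocallyCompactSpace S] [SecondCountableTopology S]
    [MeasurableSpace S] [BorelSpace S] {D : Set E} {μ : E → Measure S}
    (hμ : IsParametrizedProb D μ) :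
    ∃ κ : ProbabilityTheory.Kernel E S, ProbabilityTheory.IsFiniteKernel κ ∧
      ∀ᵐ x ∂(volume.restrict D), μ x = κ x := by
  classical
  obtain ⟨ι, hι, K, hK, hgen⟩ := exists_countable_compact_generateFrom S
  have hF : ∀ F : Finset ι, AEMeasurable (fun x => μ x (⋂ i ∈ F, K i)) (volume.restrict D) := by
    intro F
    obtain rfl | ⟨i, hi⟩ := F.eq_empty_or_nonempty
    · refine (aemeasurable_const (b := (1 : ℝ≥0∞))).congr ?_
      filter_upwards [hμ.2] with x hx
      simp
    · exact aemeasurable_measure_of_isCompact hμ <| (hK i).of_isClosed_subset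
        (isClosed_biInter fun j _ => (hK j).isClosed) (biInter_subset_of_mem hi)
  have hae : ∀ᵐ x ∂(volume.restrict D), IsProbabilityMeasure (μ x) ∧
      ∀ F : Finset ι, μ x (⋂ i ∈ F, K i) = (hF F).mk _ x :=
    hμ.2.and (ae_all_iff.2 fun F => (hF F).ae_eq_mk)
  obtain ⟨N, hN, hNm, hN0⟩ := exists_measurable_superset_of_null (ae_iff.1 hae)
  have hgood : ∀ x ∉ N, IsProbabilityMeasure (μ x) ∧
      ∀ F : Finset ι, μ x (⋂ i ∈ F, K i) = (hF F).mk _ x := by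
    intro x hx
    by_contra h
    exact hx (hN h)
  -- Outside the measurable null set `N` the masses of all the generating sets agree with measurable
  -- functions. The value `0` on `N` keeps the total mass at most `1` and works even for empty `S`.
  let κ : E → Measure S := fun x => if x ∈ N then 0 else μ x
  have hκ1 : ∀ x, κ x univ ≤ 1 := by
    intro x
    by_cases hx : x ∈ N
    · simp [κ, hx]
    · have := (hgood x hx).1
      simp [κ, hx]
  have hκfin : ∀ x, IsFiniteMeasure (κ x) := fun x => ⟨(hκ1 x).trans_lt ENNReal.one_lt_top⟩
  have hκF : ∀ F : Finset ι, Measurable fun x => κ x (⋂ i ∈ F, K i) := by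
    intro F
    have : (fun x => κ x (⋂ i ∈ F, K i)) = Nᶜ.indicator ((hF F).mk _) := by
      ext x
      by_cases hx : x ∈ N
      · simp [κ, hx]
      · rw [indicator_of_mem (by exact hx), ← (hgood x hx).2 F]
        simp [κ, hx]
    rw [this]
    exact (hF F).measurable_mk.indicator hNm.compl
  have hκ : Measurable κ := by
    refine Measurable.measure_of_isPiSystem hgen ?_ ?_ ?_
    · rintro _ ⟨F, rfl⟩ _ ⟨G, rfl⟩ -
      exact ⟨F ∪ G, Finset.set_biInter_inter F G K⟩
    · rintro _ ⟨F, rfl⟩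
      exact hκF F
    · simpa using hκF ∅
  refine ⟨⟨κ, hκ⟩, ⟨⟨1, ENNReal.one_lt_top, hκ1⟩⟩, ?_⟩
  have hNae : ∀ᵐ x ∂(volume.restrict D), x ∉ N := measure_eq_zero_iff_ae_notMem.1 hN0
  filter_upwards [hNae] with x hx
  change μ x = κ x
  simp [κ, hx]

lemma IsParametrizedProb.aemeasurable_lintegral {E S : Type*} [MeasureSpace E] [TopologicalSpace S]
    [TopologicalSpace.MetrizableSpace S] [LocallyCompactSpace S] [SecondCountableTopology S]
    [MeasurableSpace S] [BorelSpace S] {D : Set E} {μ : E → Measure S}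
    (hμ : IsParametrizedProb D μ) {g : E × S → ℝ≥0∞} (hg : Measurable g) :
    AEMeasurable (fun x => ∫⁻ s, g (x, s) ∂(μ x)) (volume.restrict D) := by
  obtain ⟨κ, _, hκ⟩ := hμ.exists_kernel
  refine (Measurable.lintegral_kernel_prod_right' (κ := κ) hg).aemeasurable.congr ?_
  filter_upwards [hκ] with x hx
  rw [hx]

/-- If the measures associated with two parametrized probabilities are related by a measurable
map, then so are the integrals of nonnegative measurable functions. -/
theorem lintegral_eq_of_hat_eq {E₁ E₂ S₁ S₂ : Type*} [MeasureSpace E₁] [MeasureSpace E₂]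
    [TopologicalSpace S₁] [TopologicalSpace.MetrizableSpace S₁] [LocallyCompactSpace S₁]
    [SecondCountableTopology S₁] [MeasurableSpace S₁] [BorelSpace S₁]
    [TopologicalSpace S₂] [TopologicalSpace.MetrizableSpace S₂] [LocallyCompactSpace S₂]
    [SecondCountableTopology S₂] [MeasurableSpace S₂] [BorelSpace S₂]
    {D₁ : Set E₁} {D₂ : Set E₂} {μ₁ : E₁ → Measure S₁} {μ₂ : E₂ → Measure S₂}
    [SFinite (volume.restrict D₁)] [SFinite (volume.restrict D₂)]
    (h₁ : IsParametrizedProb D₁ μ₁) (h₂ : IsParametrizedProb D₂ μ₂)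
    {Φ : E₂ × S₂ → E₁ × S₁} (hΦ : Measurable Φ)
    (h : ∀ A, MeasurableSet A → hat D₁ μ₁ A = hat D₂ μ₂ (Φ ⁻¹' A))
    {g : E₁ × S₁ → ℝ≥0∞} (hg : Measurable g) :
    ∫⁻ x in D₁, ∫⁻ s, g (x, s) ∂(μ₁ x) = ∫⁻ p in D₂, ∫⁻ s, g (Φ (p, s)) ∂(μ₂ p) := by
  obtain ⟨κ₁, _, hκ₁⟩ := h₁.exists_kernel
  obtain ⟨κ₂, _, hκ₂⟩ := h₂.exists_kernel
  -- With kernels in place, `hat` is the composition-product measure, and the hypothesis on sets is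
  -- an identity of measures.
  have key : (volume.restrict D₁).compProd κ₁ = ((volume.restrict D₂).compProd κ₂).map Φ := by
    ext A hA
    rw [Measure.map_apply hΦ hA, Measure.compProd_apply hA, Measure.compProd_apply (hΦ hA)]
    have h' := h A hA
    unfold hat at h'
    calc _ = ∫⁻ x in D₁, μ₁ x {s | (x, s) ∈ A} := by
          refine lintegral_congr_ae ?_
          filter_upwards [hκ₁] with x hx
          rw [hx]; rfl
      _ = _ := h'
      _ = _ := by
          refine lintegral_congr_ae ?_
          filter_upwards [hκ₂] with x hx
          rw [hx]; rfl
  calc _ = ∫⁻ x in D₁, ∫⁻ s, g (x, s) ∂(κ₁ x) := by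
        refine lintegral_congr_ae ?_
        filter_upwards [hκ₁] with x hx
        rw [hx]
    _ = ∫⁻ p in D₂, ∫⁻ s, g (Φ (p, s)) ∂(κ₂ p) := by
        rw [← Measure.lintegral_compProd hg, key, lintegral_map hg hΦ,
          Measure.lintegral_compProd (f := fun p => g (Φ p)) (hg.comp hΦ)]
    _ = _ := by
        refine lintegral_congr_ae ?_
        filter_upwards [hκ₂] with x hx
        rw [hx]


/-! ### Fractional parts and the torus -/

lemma fracPart_mem_cell {d : ℕ} (x : EuclideanSpace ℝ (Fin d)) : fracPart x ∈ cell d :=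
  fun _ => ⟨Int.fract_nonneg _, Int.fract_lt_one _⟩

lemma microVars_mem_cellPow {n d : ℕ} (r : Fin n → ℝ) (x : EuclideanSpace ℝ (Fin d)) :
    microVars r x ∈ cellPow n d :=
  fun _ => fracPart_mem_cell _

lemma measurable_fracPart {d : ℕ} :
    Measurable (fracPart : EuclideanSpace ℝ (Fin d) → EuclideanSpace ℝ (Fin d)) := by
  refine (WithLp.measurable_toLp 2 (Fin d → ℝ)).comp (measurable_pi_lambda _ fun i => ?_)
  exact measurable_fract.comp (by fun_prop)

lemma measurable_microVars {n d : ℕ} (r : Fin n → ℝ) :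
    Measurable (microVars r : EuclideanSpace ℝ (Fin d) → Fin n → EuclideanSpace ℝ (Fin d)) :=
  measurable_pi_lambda _ fun _ => measurable_fracPart.comp (by fun_prop)

lemma measurableSet_cell (d : ℕ) : MeasurableSet (cell d) := by
  have : cell d = ⋂ i : Fin d, (fun y : EuclideanSpace ℝ (Fin d) => y i) ⁻¹' Ico (0 : ℝ) 1 := by
    ext y; simp [cell]
  rw [this]
  exact MeasurableSet.iInter fun i => measurableSet_Ico.preimage (by fun_prop)

lemma volume_cell (d : ℕ) : volume (cell d) = 1 := by
  have h2 : cell d = (MeasurableEquiv.toLp 2 (Fin d → ℝ)).symm ⁻¹'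
      (Set.univ.pi fun _ => Ico (0 : ℝ) 1) := by
    ext y; simp [cell]
  rw [h2, (EuclideanSpace.volume_preserving_symm_measurableEquiv_toLp (Fin d)).measure_preimage
    (MeasurableSet.univ_pi fun _ => measurableSet_Ico).nullMeasurableSet, volume_pi_pi]
  simp

lemma cellPow_eq_pi (n d : ℕ) : cellPow n d = Set.univ.pi fun _ => cell d := by
  ext y; simp [cellPow]

lemma measurableSet_cellPow (n d : ℕ) : MeasurableSet (cellPow n d) := by
  rw [cellPow_eq_pi]
  exact MeasurableSet.univ_pi fun _ => measurableSet_cell d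

lemma volume_cellPow (n d : ℕ) : volume (cellPow n d) = 1 := by
  rw [cellPow_eq_pi, volume_pi_pi]
  simp [volume_cell]

lemma continuous_toTorus {n d : ℕ} :
    Continuous (toTorus : (Fin n → EuclideanSpace ℝ (Fin d)) → Fin n → UnitAddTorus (Fin d)) := by
  refine continuous_pi fun k => continuous_pi fun i => ?_
  exact (AddCircle.continuous_mk' 1).comp (by fun_prop)

lemma injOn_toTorus {n d : ℕ} : InjOn (toTorus (n := n) (d := d)) (cellPow n d) := by
  intro y hy y' hy' h
  funext k
  ext i
  have h' : ((y k i : ℝ) : UnitAddCircle) = ((y' k i : ℝ) : UnitAddCircle) :=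
    congr_fun (congr_fun h k) i
  have : Fact ((0 : ℝ) < 1) := ⟨one_pos⟩
  exact (AddCircle.coe_eq_coe_iff_of_mem_Ico (a := (0 : ℝ)) (p := 1)
    (by simpa using hy k i) (by simpa using hy' k i)).1 h'

open scoped Pointwise in
/-- Uniform bound for the distribution of `⟨x / r⟩`, `x ∈ Ω`. -/
lemma exists_volume_fracPart_le {d : ℕ} {Ω : Set (EuclideanSpace ℝ (Fin d))}
    (hΩb : Bornology.IsBounded Ω) :
    ∃ L : ℝ, 0 ≤ L ∧ ∀ r : ℝ, 0 < r → ∀ N : Set (EuclideanSpace ℝ (Fin d)),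
      volume {x ∈ Ω | fracPart (r⁻¹ • x) ∈ N}
        ≤ ENNReal.ofReal ((2 * L + 5 * r) ^ d) * volume N := by
  obtain ⟨L, hL0, hL⟩ := hΩb.exists_pos_norm_le
  refine ⟨L, hL0.le, fun r hr N => ?_⟩
  -- The coordinates of `x / r` are at most `L / r` in absolute value, so the integer part of `x /
  -- r` lies in `I`. The set is covered by `(2K + 1)^d` translates of `N` scaled by `r`, and `K ≤ L
  -- / r + 2` gives `(2K + 1) r ≤ 2L + 5r`.
  let K : ℕ := ⌈L / r⌉₊ + 1
  let I : Finset (Fin d → ℤ) := Fintype.piFinset fun _ => Finset.Icc (-(K : ℤ)) K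
  let v : (Fin d → ℤ) → EuclideanSpace ℝ (Fin d) := fun k => WithLp.toLp 2 fun i => (k i : ℝ)
  have hsub : {x ∈ Ω | fracPart (r⁻¹ • x) ∈ N} ⊆ ⋃ k ∈ I, r • (v k +ᵥ N) := by
    rintro x ⟨hxΩ, hxN⟩
    refine mem_biUnion (x := fun i => ⌊(r⁻¹ • x) i⌋) ?_ ?_
    · simp only [I, SetLike.mem_coe, Fintype.mem_piFinset, Finset.mem_Icc]
      intro i
      have h1 : |(r⁻¹ • x) i| ≤ L / r := by
        rw [PiLp.smul_apply, smul_eq_mul, abs_mul, abs_of_pos (inv_pos.2 hr), inv_mul_eq_div]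
        gcongr
        exact (PiLp.norm_apply_le x i).trans (hL x hxΩ)
      have h2 := Nat.le_ceil (L / r)
      have h3 := abs_le.1 h1
      constructor
      · rw [Int.le_floor]
        simp only [K]
        push_cast
        linarith
      · have h4 : ((⌊(r⁻¹ • x) i⌋ : ℤ) : ℝ) ≤ K := by
          have := Int.floor_le ((r⁻¹ • x) i)
          simp only [K]
          push_cast
          linarith
        exact_mod_cast h4
    · refine ⟨r⁻¹ • x, ⟨fracPart (r⁻¹ • x), hxN, ?_⟩, smul_inv_smul₀ hr.ne' x⟩
      ext i
      change (⌊(r⁻¹ • x) i⌋ : ℝ) + Int.fract ((r⁻¹ • x) i) = (r⁻¹ • x) i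
      exact Int.floor_add_fract _
  have hcard : I.card = (2 * K + 1) ^ d := by
    simp only [I, Fintype.card_piFinset, Int.card_Icc, Finset.prod_const, Finset.card_univ,
      Fintype.card_fin]
    congr 1
    omega
  have hK : (K : ℝ) ≤ L / r + 2 := by
    have := Nat.ceil_lt_add_one (div_nonneg hL0.le hr.le)
    simp only [K]
    push_cast
    linarith
  calc volume {x ∈ Ω | fracPart (r⁻¹ • x) ∈ N}
      ≤ ∑ k ∈ I, volume (r • (v k +ᵥ N)) :=
        (measure_mono hsub).trans (measure_biUnion_finset_le _ _)
    _ = ∑ k ∈ I, ENNReal.ofReal (r ^ d) * volume N := by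
        refine Finset.sum_congr rfl fun k _ => ?_
        rw [Measure.addHaar_smul, measure_vadd, finrank_euclideanSpace_fin,
          abs_of_pos (pow_pos hr d)]
    _ = ENNReal.ofReal (((2 * K + 1) * r) ^ d) * volume N := by
        rw [Finset.sum_const, hcard, nsmul_eq_mul, ← mul_assoc, mul_pow,
          ENNReal.ofReal_mul (by positivity)]
        congr 2
        rw [← ENNReal.ofReal_natCast]
        push_cast
        rfl
    _ ≤ ENNReal.ofReal ((2 * L + 5 * r) ^ d) * volume N := by
        gcongr
        calc (2 * (K : ℝ) + 1) * r ≤ (2 * (L / r + 2) + 1) * r := by gcongr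
          _ = 2 * L + 5 * r := by field_simp; ring

/-! ### Continuous families in `C₀` -/

/-- A continuous function on `E × S` that vanishes off `E × K`, `K` compact, as a function
`E → C₀(S)`. -/
def toZeroAtInfty {E S : Type*} [TopologicalSpace E] [TopologicalSpace S]
    (G : C(E × S, ℝ)) (K : Set S) (hK : IsCompact K) [T2Space S]
    (h0 : ∀ x, ∀ s ∉ K, G (x, s) = 0) (x : E) : C₀(S, ℝ) :=
  ⟨⟨fun s => G (x, s), by fun_prop⟩,
    (HasCompactSupport.intro hK fun s hs => h0 x s hs).is_zero_at_infty⟩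

/-- Currying gives continuity into `C(K, ℝ)` with the uniform distance. Off `K` all the functions
vanish, so this distance controls the one in `C₀`. -/
lemma continuous_toZeroAtInfty {E S : Type*} [TopologicalSpace E] [TopologicalSpace S]
    (G : C(E × S, ℝ)) (K : Set S) (hK : IsCompact K) [T2Space S]
    (h0 : ∀ x, ∀ s ∉ K, G (x, s) = 0) : Continuous (toZeroAtInfty G K hK h0) := by
  have : CompactSpace K := isCompact_iff_compactSpace.1 hK
  let H : C(E, C(K, ℝ)) := ContinuousMap.curry ⟨fun p : E × K => G (p.1, p.2), by fun_prop⟩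
  refine continuous_iff_continuousAt.2 fun x => ?_
  refine tendsto_iff_dist_tendsto_zero.2 ?_
  refine squeeze_zero (fun _ => dist_nonneg) (fun x' => ?_)
    (tendsto_iff_dist_tendsto_zero.1 (H.continuous.tendsto x))
  rw [← ZeroAtInftyContinuousMap.dist_toBCF_eq_dist]
  refine (BoundedContinuousFunction.dist_le dist_nonneg).2 fun s => ?_
  change dist (G (x', s)) (G (x, s)) ≤ _
  by_cases hs : s ∈ K
  · exact ContinuousMap.dist_apply_le_dist (f := H x') (g := H x) ⟨s, hs⟩
  · rw [h0 _ _ hs, h0 _ _ hs, dist_self]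
    exact dist_nonneg

lemma integrable_toZeroAtInfty {E S : Type*} [TopologicalSpace E] [MeasurableSpace E]
    [BorelSpace E] [SecondCountableTopology E] [TopologicalSpace S] {μ : Measure E}
    [IsFiniteMeasure μ] (G : C(E × S, ℝ)) (K : Set S) (hK : IsCompact K) [T2Space S]
    (h0 : ∀ x, ∀ s ∉ K, G (x, s) = 0) {M : ℝ} (hM : 0 ≤ M) (hG : ∀ p, |G p| ≤ M) :
    Integrable (toZeroAtInfty G K hK h0) μ := by
  refine Integrable.of_bound (C := M) ?_ (Eventually.of_forall fun x => ?_)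
  · exact (continuous_toZeroAtInfty G K hK h0).aestronglyMeasurable
  · rw [← ZeroAtInftyContinuousMap.norm_toBCF_eq_norm]
    exact (BoundedContinuousFunction.norm_le hM).2 fun s => hG (x, s)


/-- Convergence for a generated Young measure, in terms of lower Lebesgue integrals. -/
theorem GeneratesYoungMeasure.tendsto_lintegral {E S : Type*} [TopologicalSpace E] [MeasureSpace E]
    [BorelSpace E] [SecondCountableTopology E] [TopologicalSpace S]
    [TopologicalSpace.MetrizableSpace S] [LocallyCompactSpace S] [SecondCountableTopology S]
    [MeasurableSpace S] [BorelSpace S] {D : Set E} [IsFiniteMeasure ((volume : Measure E).restrict D)]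
    {w : ℕ → E → S} {μ : E → Measure S} (h : GeneratesYoungMeasure D w μ)
    (hw : ∀ j, AEMeasurable (w j) (volume.restrict D)) (G : C(E × S, ℝ)) {K : Set S}
    (hK : IsCompact K) (h0 : ∀ x, ∀ s ∉ K, G (x, s) = 0) {M : ℝ} (hG : ∀ p, G p ∈ Icc 0 M) :
    Tendsto (fun j => ∫⁻ x in D, ENNReal.ofReal (G (x, w j x))) atTop
      (𝓝 (∫⁻ x in D, ∫⁻ s, ENNReal.ofReal (G (x, s)) ∂(μ x))) := by
  obtain hE | ⟨⟨x₀⟩⟩ := isEmpty_or_nonempty E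
  · simp [Measure.eq_zero_of_isEmpty]
  obtain hS | ⟨⟨s₀⟩⟩ := isEmpty_or_nonempty S
  · exact (hS.false (w 0 x₀)).elim
  have hM : 0 ≤ M := (hG (x₀, s₀)).1.trans (hG (x₀, s₀)).2
  have hGm : Measurable fun p => ENNReal.ofReal (G p) := G.continuous.measurable.ennreal_ofReal
  have hlim := h.2 (toZeroAtInfty G K hK h0)
    (integrable_toZeroAtInfty G K hK h0 hM fun p => abs_le.2 ⟨by linarith [(hG p).1], (hG p).2⟩)
  have hfin : ∀ g : E → ℝ≥0∞, (∀ᵐ x ∂(volume.restrict D), g x ≤ ENNReal.ofReal M) →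
      ∫⁻ x in D, g x ≠ ∞ := by
    intro g hg
    refine ((lintegral_mono_ae hg).trans_lt ?_).ne
    rw [lintegral_const]
    exact ENNReal.mul_lt_top ENNReal.ofReal_lt_top (measure_lt_top _ _)
  have hI : ∀ᵐ x ∂(volume.restrict D),
      ∫⁻ s, ENNReal.ofReal (G (x, s)) ∂(μ x) ≤ ENNReal.ofReal M := by
    filter_upwards [h.1.2] with x hx
    calc _ ≤ ∫⁻ _, ENNReal.ofReal M ∂(μ x) :=
          lintegral_mono fun s => ENNReal.ofReal_le_ofReal (hG (x, s)).2
      _ = _ := by simp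
  have e1 : ∀ j, ENNReal.ofReal (∫ x in D, toZeroAtInfty G K hK h0 x (w j x))
      = ∫⁻ x in D, ENNReal.ofReal (G (x, w j x)) := by
    intro j
    change ENNReal.ofReal (∫ x in D, G (x, w j x)) = _
    have hm : AEMeasurable (fun x => G (x, w j x)) (volume.restrict D) :=
      G.continuous.measurable.comp_aemeasurable (aemeasurable_id.prodMk (hw j))
    rw [integral_eq_lintegral_of_nonneg_ae (Eventually.of_forall fun x => (hG _).1)
      hm.aestronglyMeasurable, ENNReal.ofReal_toReal]
    exact hfin _ (Eventually.of_forall fun x => ENNReal.ofReal_le_ofReal (hG _).2)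
  have e2 : ENNReal.ofReal (∫ x in D, ∫ s, toZeroAtInfty G K hK h0 x s ∂(μ x))
      = ∫⁻ x in D, ∫⁻ s, ENNReal.ofReal (G (x, s)) ∂(μ x) := by
    have : ∀ x, ∫ s, toZeroAtInfty G K hK h0 x s ∂(μ x)
        = (∫⁻ s, ENNReal.ofReal (G (x, s)) ∂(μ x)).toReal := fun x =>
      integral_eq_lintegral_of_nonneg_ae (Eventually.of_forall fun s => (hG _).1)
        (toZeroAtInfty G K hK h0 x).continuous.aestronglyMeasurable
    simp_rw [this]
    rw [integral_toReal (h.1.aemeasurable_lintegral hGm)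
      (hI.mono fun x hx => hx.trans_lt ENNReal.ofReal_lt_top), ENNReal.ofReal_toReal (hfin _ hI)]
  rw [← e2]
  simp_rw [← e1]
  exact ENNReal.tendsto_ofReal hlim

/-- Truncation and continuous extension of an integrand that is continuous on `X × Yⁿ × ℝᵐ`. -/
theorem exists_truncated_extension {n d m : ℕ} {X Y : Set (EuclideanSpace ℝ (Fin d))}
    (hX : IsCompact X) (hY : IsCompact Y) (hYc : Y ⊆ cell d)
    {f : EuclideanSpace ℝ (Fin d) → (Fin n → EuclideanSpace ℝ (Fin d)) →
      EuclideanSpace ℝ (Fin m) → ℝ}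
    (hf : ContinuousOn
      (fun p : EuclideanSpace ℝ (Fin d) × (Fin n → EuclideanSpace ℝ (Fin d)) ×
        EuclideanSpace ℝ (Fin m) => f p.1 p.2.1 p.2.2)
      (X ×ˢ ({y | ∀ k, y k ∈ Y} ×ˢ univ)))
    (hf0 : ∀ x ∈ X, ∀ y, (∀ k, y k ∈ Y) → ∀ z, 0 ≤ f x y z) {R M : ℝ} (hM : 0 ≤ M)
    (hfM : ∀ x ∈ X, ∀ y, (∀ k, y k ∈ Y) → ∀ z, ‖z‖ ≤ R + 1 → f x y z ≤ M) :
    ∃ G : C(EuclideanSpace ℝ (Fin d) ×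
        ((Fin n → UnitAddTorus (Fin d)) × EuclideanSpace ℝ (Fin m)), ℝ),
      (∀ p, G p ∈ Icc 0 M) ∧ (∀ x t z, R + 1 ≤ ‖z‖ → G (x, (t, z)) = 0) ∧
      (∀ x ∈ X, ∀ y, (∀ k, y k ∈ Y) → ∀ z, ‖z‖ ≤ R → G (x, (toTorus y, z)) = f x y z) ∧
      (∀ x ∈ X, ∀ y, (∀ k, y k ∈ Y) → ∀ z, G (x, (toTorus y, z)) ≤ f x y z) := by
  let Q : Set (EuclideanSpace ℝ (Fin d) × (Fin n → EuclideanSpace ℝ (Fin d)) ×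
      EuclideanSpace ℝ (Fin m)) := X ×ˢ ({y | ∀ k, y k ∈ Y} ×ˢ Metric.closedBall 0 (R + 1))
  have hYn : IsCompact {y : Fin n → EuclideanSpace ℝ (Fin d) | ∀ k, y k ∈ Y} := by
    simpa [Set.pi] using isCompact_univ_pi fun _ : Fin n => hY
  have hQ : IsCompact Q := hX.prod (hYn.prod (isCompact_closedBall _ _))
  have : CompactSpace Q := isCompact_iff_compactSpace.1 hQ
  -- A continuous injection of the compact set `Q` is a closed embedding; injectivity uses that `Y`
  -- lies in the half-open cell.
  let e : Q → EuclideanSpace ℝ (Fin d) ×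
        ((Fin n → UnitAddTorus (Fin d)) × EuclideanSpace ℝ (Fin m)) :=
    fun p => (p.1.1, (toTorus p.1.2.1, p.1.2.2))
  have he : Topology.IsClosedEmbedding e := by
    refine Continuous.isClosedEmbedding ?_ ?_
    · have := continuous_toTorus (n := n) (d := d)
      fun_prop
    · rintro ⟨⟨x, y, z⟩, hx, hy, hz⟩ ⟨⟨x', y', z'⟩, hx', hy', hz'⟩ h
      simp only [e, Prod.mk.injEq] at h
      obtain ⟨rfl, h2, rfl⟩ := h
      obtain rfl := injOn_toTorus (fun k => hYc (hy k)) (fun k => hYc (hy' k)) h2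
      rfl
  let g : BoundedContinuousFunction Q ℝ := BoundedContinuousFunction.mkOfCompact
    ⟨fun p => f p.1.1 p.1.2.1 p.1.2.2,
      (hf.mono (prod_mono_right (prod_mono_right (subset_univ _)))).domRestrict⟩
  have hg : ∀ p, g p ∈ Icc 0 M := by
    rintro ⟨⟨x, y, z⟩, hx, hy, hz⟩
    exact ⟨hf0 x hx y hy z, hfM x hx y hy z (by simpa using hz)⟩
  obtain ⟨G, hG, hGe⟩ :=
    BoundedContinuousFunction.exists_extension_forall_mem_Icc_of_isClosedEmbedding g hg hM he
  have hGf : ∀ x ∈ X, ∀ y, (∀ k, y k ∈ Y) → ∀ z, ‖z‖ ≤ R + 1 →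
      G (x, (toTorus y, z)) = f x y z := fun x hx y hy z hz =>
    congr_fun hGe ⟨(x, y, z), hx, hy, by simpa using hz⟩
  -- Cutoff equal to `1` for `‖z‖ ≤ R` and to `0` for `‖z‖ ≥ R + 1`. The extension is controlled by
  -- `f` up to radius `R + 1`, hence the bound `M` is required there.
  let θ : EuclideanSpace ℝ (Fin m) → ℝ := fun z => max 0 (min 1 (R + 1 - ‖z‖))
  have hθ0 : ∀ z, 0 ≤ θ z := fun z => le_max_left _ _
  have hθ1 : ∀ z, θ z ≤ 1 := fun z => max_le zero_le_one (min_le_left _ _)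
  have hθR : ∀ z, R + 1 ≤ ‖z‖ → θ z = 0 := fun z hz =>
    max_eq_left ((min_le_right _ _).trans (by linarith))
  refine ⟨⟨fun p => θ p.2.2 * G p, by fun_prop⟩, fun p => ⟨?_, ?_⟩, fun x t z hz => ?_,
    fun x hx y hy z hz => ?_, fun x hx y hy z => ?_⟩
  · exact mul_nonneg (hθ0 _) (hG p).1
  · exact (mul_le_of_le_one_left (hG p).1 (hθ1 _)).trans (hG p).2
  · change θ z * _ = 0
    rw [hθR z hz, zero_mul]
  · change θ z * _ = _
    have : θ z = 1 := by
      simp only [θ]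
      rw [min_eq_left (by linarith), max_eq_right zero_le_one]
    rw [this, one_mul, hGf x hx y hy z (by linarith)]
  · change θ z * G (x, (toTorus y, z)) ≤ _
    by_cases hz : ‖z‖ ≤ R + 1
    · rw [hGf x hx y hy z hz]
      exact mul_le_of_le_one_left (hf0 x hx y hy z) (hθ1 z)
    · rw [hθR z (not_le.1 hz).le, zero_mul]
      exact hf0 x hx y hy z

/-! ### Exceptional sets -/

/-- Union bound: either `x ∉ X`, or some coordinate `y k` misses `Y` while the other cells
contribute a factor `1`. -/
lemma volume_prod_diff_le {n d : ℕ} {Ω X Y : Set (EuclideanSpace ℝ (Fin d))} {δ : ℝ≥0∞}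
    (hX : volume (Ω \ X) ≤ δ) (hY : volume (cell d \ Y) ≤ δ) :
    volume ((Ω ×ˢ cellPow n d) \ (X ×ˢ {y | ∀ k, y k ∈ Y})) ≤ (1 + n * volume Ω) * δ := by
  classical
  have hsub : (Ω ×ˢ cellPow n d) \ (X ×ˢ {y | ∀ k, y k ∈ Y}) ⊆
      ((Ω \ X) ×ˢ cellPow n d) ∪ ⋃ k : Fin n, Ω ×ˢ
        (Set.univ.pi (Function.update (fun _ => cell d) k (cell d \ Y))) := by
    rintro ⟨x, y⟩ ⟨⟨hx, hy⟩, h⟩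
    by_cases hxX : x ∈ X
    · obtain ⟨k, hk⟩ : ∃ k, y k ∉ Y := by
        by_contra! h'
        exact h ⟨hxX, h'⟩
      refine Or.inr (mem_iUnion.2 ⟨k, hx, fun l _ => ?_⟩)
      by_cases hl : l = k
      · subst hl
        simpa using ⟨hy l, hk⟩
      · simpa [hl] using hy l
    · exact Or.inl ⟨⟨hx, hxX⟩, hy⟩
  have hk : ∀ k : Fin n, (volume : Measure (Fin n → EuclideanSpace ℝ (Fin d)))
      (Set.univ.pi (Function.update (fun _ => cell d) k (cell d \ Y))) ≤ δ := by
    intro k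
    rw [volume_pi_pi, Finset.prod_eq_single k]
    · simpa using hY
    · intro l _ hl
      simp [hl, volume_cell]
    · simp
  calc _ ≤ volume ((Ω \ X) ×ˢ cellPow n d) + ∑ k : Fin n, volume (Ω ×ˢ
        (Set.univ.pi (Function.update (fun _ => cell d) k (cell d \ Y)))) :=
        (measure_mono hsub).trans <| (measure_union_le _ _).trans <| by
          gcongr
          exact measure_iUnion_fintype_le _ _
    _ ≤ δ + ∑ _k : Fin n, volume Ω * δ := by
        simp only [Measure.volume_eq_prod, Measure.prod_prod]
        rw [volume_cellPow, mul_one]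
        gcongr with k
        exact hk k
    _ = _ := by
        simp
        ring

/-- The same union bound along the oscillating variables, with the distribution estimate in place of
the product structure. The constant stays bounded as long as the scales do. -/
lemma volume_microVars_notMem_le {n d : ℕ} {Ω X Y : Set (EuclideanSpace ℝ (Fin d))} {δ : ℝ≥0∞}
    (hX : volume (Ω \ X) ≤ δ) (hY : volume (cell d \ Y) ≤ δ) {L : ℝ}
    (hL : ∀ r : ℝ, 0 < r → ∀ N : Set (EuclideanSpace ℝ (Fin d)),
      volume {x ∈ Ω | fracPart (r⁻¹ • x) ∈ N}
        ≤ ENNReal.ofReal ((2 * L + 5 * r) ^ d) * volume N)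
    {r : Fin n → ℝ} (hr : ∀ k, 0 < r k) :
    volume (Ω \ {x | x ∈ X ∧ ∀ k, microVars r x k ∈ Y}) ≤
      (1 + ∑ k, ENNReal.ofReal ((2 * L + 5 * r k) ^ d)) * δ := by
  have hsub : Ω \ {x | x ∈ X ∧ ∀ k, microVars r x k ∈ Y} ⊆
      (Ω \ X) ∪ ⋃ k, {x ∈ Ω | fracPart ((r k)⁻¹ • x) ∈ cell d \ Y} := by
    rintro x ⟨hx, h⟩
    by_cases hxX : x ∈ X
    · obtain ⟨k, hk⟩ : ∃ k, microVars r x k ∉ Y := by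
        by_contra! h'
        exact h ⟨hxX, h'⟩
      exact Or.inr (mem_iUnion.2 ⟨k, hx, fracPart_mem_cell _, hk⟩)
    · exact Or.inl ⟨hx, hxX⟩
  calc _ ≤ volume (Ω \ X) + ∑ k, volume {x ∈ Ω | fracPart ((r k)⁻¹ • x) ∈ cell d \ Y} :=
        (measure_mono hsub).trans <| (measure_union_le _ _).trans <| by
          gcongr
          exact measure_iUnion_fintype_le _ _
    _ ≤ δ + ∑ k, ENNReal.ofReal ((2 * L + 5 * r k) ^ d) * δ := by
        gcongr with k
        exact (hL (r k) (hr k) _).trans (by gcongr)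
    _ = _ := by rw [add_mul, one_mul, Finset.sum_mul]

/-- An admissible integrand has a Borel representative. -/
theorem IsAdmissibleIntegrand.exists_measurable {n d m : ℕ} {Ω : Set (EuclideanSpace ℝ (Fin d))}
    (hΩb : Bornology.IsBounded Ω)
    {f : EuclideanSpace ℝ (Fin d) → (Fin n → EuclideanSpace ℝ (Fin d)) →
      EuclideanSpace ℝ (Fin m) → ℝ} (hf : IsAdmissibleIntegrand Ω f) :
    ∃ (F : (EuclideanSpace ℝ (Fin d) × (Fin n → EuclideanSpace ℝ (Fin d))) ×
        EuclideanSpace ℝ (Fin m) → ℝ≥0∞)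
      (W : Set (EuclideanSpace ℝ (Fin d) × (Fin n → EuclideanSpace ℝ (Fin d)))),
      Measurable F ∧ W ⊆ Ω ×ˢ cellPow n d ∧
      (∀ p ∈ W, ∀ z, F (p, z) = ENNReal.ofReal (f p.1 p.2 z)) ∧
      volume ((Ω ×ˢ cellPow n d) \ W) = 0 ∧
      ∀ r : Fin n → ℝ, (∀ k, 0 < r k) → volume (Ω \ {x | (x, microVars r x) ∈ W}) = 0 := by
  classical
  have hδ : ∀ j : ℕ, (0 : ℝ) < 1 / ((j : ℝ) + 1) := fun j => Nat.one_div_pos_of_nat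
  choose X Y hXc hXΩ hXv hYc hYcell hYv hcont using fun j : ℕ => hf.2 _ (hδ j)
  let V : ℕ → Set (EuclideanSpace ℝ (Fin d) × (Fin n → EuclideanSpace ℝ (Fin d))) :=
    fun j => X j ×ˢ {y | ∀ k, y k ∈ Y j}
  have hVm : ∀ j, MeasurableSet (V j) := fun j => (hXc j).measurableSet.prod <| by
    have := MeasurableSet.univ_pi fun _ : Fin n => (hYc j).measurableSet
    simpa [Set.pi] using this
  -- Each term is `f` on a compact set times `ℝᵐ`, where `f` is continuous, and `0` elsewhere; the
  -- supremum therefore equals `f` on the union.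
  let F : (EuclideanSpace ℝ (Fin d) × (Fin n → EuclideanSpace ℝ (Fin d))) ×
        EuclideanSpace ℝ (Fin m) → ℝ≥0∞ := fun p =>
    ⨆ j, (V j ×ˢ univ).indicator (fun p => ENNReal.ofReal (f p.1.1 p.1.2 p.2)) p
  have hnull : ∀ (a : ℝ≥0∞) (C : ℝ≥0∞), C ≠ ∞ →
      (∀ j : ℕ, a ≤ C * ENNReal.ofReal (1 / ((j : ℝ) + 1))) → a = 0 := by
    intro a C hC ha
    have ht : Tendsto (fun j : ℕ => C * ENNReal.ofReal (1 / ((j : ℝ) + 1))) atTop (𝓝 0) := by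
      have := ENNReal.Tendsto.const_mul (a := C)
        (ENNReal.tendsto_ofReal tendsto_one_div_add_atTop_nhds_zero_nat) (Or.inr hC)
      simpa using this
    exact le_antisymm (ge_of_tendsto' ht ha) zero_le
  have hsub : ∀ j, V j ⊆ ⋃ i, V i := subset_iUnion V
  refine ⟨F, ⋃ j, V j, ?_, ?_, ?_, ?_, ?_⟩
  · refine Measurable.iSup fun j => ?_
    have hc : ContinuousOn (fun p : (EuclideanSpace ℝ (Fin d) ×
        (Fin n → EuclideanSpace ℝ (Fin d))) × EuclideanSpace ℝ (Fin m) =>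
        ENNReal.ofReal (f p.1.1 p.1.2 p.2)) (V j ×ˢ univ) := by
      refine ENNReal.continuous_ofReal.comp_continuousOn ?_
      exact (hcont j).comp (f := fun p : (EuclideanSpace ℝ (Fin d) ×
        (Fin n → EuclideanSpace ℝ (Fin d))) × EuclideanSpace ℝ (Fin m) =>
        (p.1.1, p.1.2, p.2)) (by fun_prop) fun p hp => ⟨hp.1.1, hp.1.2, trivial⟩
    rw [← piecewise_eq_indicator]
    exact hc.measurable_piecewise continuousOn_const ((hVm j).prod MeasurableSet.univ)
  · exact iUnion_subset fun j => prod_mono (hXΩ j) fun y hy k => hYcell j (hy k)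
  · intro p hp z
    obtain ⟨i, hi⟩ := mem_iUnion.1 hp
    refine le_antisymm (iSup_le fun j => indicator_le_self _ _ _) ?_
    refine le_iSup_of_le i ?_
    rw [indicator_of_mem (show (p, z) ∈ V i ×ˢ univ from ⟨hi, trivial⟩)]
  · refine hnull _ (1 + n * volume Ω) ?_ fun j => ?_
    · exact ENNReal.add_ne_top.2 ⟨ENNReal.one_ne_top,
        ENNReal.mul_ne_top (ENNReal.natCast_ne_top n) hΩb.measure_lt_top.ne⟩
    · exact (measure_mono (sdiff_subset_sdiff_right (hsub j))).trans
        (volume_prod_diff_le (hXv j) (hYv j))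
  -- The graph of `microVars r` may itself be null in the product, so the previous item does not
  -- suffice and the distribution bound is needed.
  · intro r hr
    obtain ⟨L, -, hL⟩ := exists_volume_fracPart_le hΩb
    refine hnull _ (1 + ∑ k, ENNReal.ofReal ((2 * L + 5 * r k) ^ d)) ?_ fun j => ?_
    · simp [ENNReal.sum_eq_top]
    · refine (measure_mono (sdiff_subset_sdiff_right ?_)).trans
        (volume_microVars_notMem_le (hXv j) (hYv j) hL hr)
      exact fun x hx => hsub j hx


/-! ### Lower semicontinuity for truncated integrands -/

/-- Lower bound for the integrals of the truncations of an admissible integrand to balls. -/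
theorem lintegral_closedBall_le_liminf {n d m : ℕ} {Ω : Set (EuclideanSpace ℝ (Fin d))}
    (hΩ : MeasurableSet Ω) (hΩb : Bornology.IsBounded Ω) {r : Fin n → ℕ → ℝ}
    (hr : ∀ k h, 0 < r k h) (hr1 : ∀ᶠ h in atTop, ∀ k, r k h ≤ 1)
    {u : ℕ → EuclideanSpace ℝ (Fin d) → EuclideanSpace ℝ (Fin m)}
    (hu : ∀ h, AEMeasurable (u h) (volume.restrict Ω))
    {ν : EuclideanSpace ℝ (Fin d) × (Fin n → EuclideanSpace ℝ (Fin d)) →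
      Measure (EuclideanSpace ℝ (Fin m))}
    (hν : GeneratesMultiscaleYoungMeasure Ω r u ν)
    {f : EuclideanSpace ℝ (Fin d) → (Fin n → EuclideanSpace ℝ (Fin d)) →
      EuclideanSpace ℝ (Fin m) → ℝ} (hf : IsAdmissibleIntegrand Ω f) {R M : ℝ} (hM : 0 ≤ M)
    (hfM : ∀ x ∈ Ω, ∀ y ∈ cellPow n d, ∀ z, ‖z‖ ≤ R + 1 → f x y z ≤ M) :
    ∫⁻ p in Ω ×ˢ cellPow n d, ∫⁻ z in Metric.closedBall 0 R, ENNReal.ofReal (f p.1 p.2 z) ∂(ν p)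
      ≤ liminf (fun h => ∫⁻ x in Ω, ENNReal.ofReal
            (f x (microVars (fun k => r k h) x) (u h x))) atTop := by
  have : BorelSpace (UnitAddTorus (Fin d)) := Pi.borelSpace
  have : IsFiniteMeasure ((volume : Measure (EuclideanSpace ℝ (Fin d))).restrict Ω) :=
    ⟨by simpa using hΩb.measure_lt_top⟩
  obtain ⟨hνP, μ, hμ, hhat⟩ := hν
  obtain ⟨L, hL0, hL⟩ := exists_volume_fracPart_le hΩb
  have hwm : ∀ h, AEMeasurable (fun x => (toTorus (microVars (fun k => r k h) x), u h x))
      (volume.restrict Ω) := fun h =>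
    (continuous_toTorus.measurable.comp (measurable_microVars _)).aemeasurable.prodMk (hu h)
  set C₁ : ℝ≥0∞ := 1 + n * volume Ω
  -- Once all scales are at most `1`, `2L + 5r ≤ 2L + 5`, which makes the error independent of `h`.
  set C₂ : ℝ≥0∞ := 1 + ∑ _k : Fin n, ENNReal.ofReal ((2 * L + 5) ^ d) with hC₂
  have hC₁' : C₁ ≠ ∞ := ENNReal.add_ne_top.2 ⟨ENNReal.one_ne_top,
    ENNReal.mul_ne_top (ENNReal.natCast_ne_top n) hΩb.measure_lt_top.ne⟩
  have hC₂' : C₂ ≠ ∞ := by simp [hC₂, ENNReal.mul_eq_top]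
  suffices key : ∀ δ : ℝ, 0 < δ →
      ∫⁻ p in Ω ×ˢ cellPow n d, ∫⁻ z in Metric.closedBall 0 R,
          ENNReal.ofReal (f p.1 p.2 z) ∂(ν p)
        ≤ liminf (fun h => ∫⁻ x in Ω, ENNReal.ofReal
            (f x (microVars (fun k => r k h) x) (u h x))) atTop
          + ENNReal.ofReal M * (C₂ + C₁) * ENNReal.ofReal δ by
    have hC : ENNReal.ofReal M * (C₂ + C₁) ≠ ∞ :=
      ENNReal.mul_ne_top ENNReal.ofReal_ne_top (ENNReal.add_ne_top.2 ⟨hC₂', hC₁'⟩)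
    refine ge_of_tendsto' (x := atTop) ?_ fun j : ℕ => key (1 / ((j : ℝ) + 1)) Nat.one_div_pos_of_nat
    have := (ENNReal.Tendsto.const_mul (a := ENNReal.ofReal M * (C₂ + C₁))
      (ENNReal.tendsto_ofReal tendsto_one_div_add_atTop_nhds_zero_nat) (Or.inr hC)).const_add
      (liminf (fun h => ∫⁻ x in Ω, ENNReal.ofReal
            (f x (microVars (fun k => r k h) x) (u h x))) atTop)
    simpa using this
  intro δ hδ
  obtain ⟨X, Y, hXc, hXΩ, hXv, hYc, hYcell, hYv, hcont⟩ := hf.2 δ hδ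
  have hYn : ∀ y : Fin n → EuclideanSpace ℝ (Fin d), (∀ k, y k ∈ Y) → y ∈ cellPow n d :=
    fun y hy k => hYcell (hy k)
  have hYnm : MeasurableSet {y : Fin n → EuclideanSpace ℝ (Fin d) | ∀ k, y k ∈ Y} := by
    have := MeasurableSet.univ_pi fun _ : Fin n => hYc.measurableSet
    simpa [Set.pi] using this
  obtain ⟨G, hGM, hG0, hGeq, hGle⟩ := exists_truncated_extension hXc hYc hYcell hcont
    (fun x hx y hy => hf.1 x (hXΩ hx) y (hYn y hy)) hM
    (fun x hx y hy => hfM x (hXΩ hx) y (hYn y hy))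
  have hlim := hμ.tendsto_lintegral hwm G
    (K := univ ×ˢ Metric.closedBall 0 (R + 1)) (isCompact_univ.prod (isCompact_closedBall _ _))
    (by
      rintro x ⟨t, z⟩ hs
      refine hG0 x t z ?_
      simp only [mem_prod, mem_univ, true_and, mem_closedBall_zero_iff, not_le] at hs
      exact hs.le) hGM
  have hGm : Measurable fun p => ENNReal.ofReal (G p) := G.continuous.measurable.ennreal_ofReal
  rw [lintegral_eq_of_hat_eq (Φ := fun p : (EuclideanSpace ℝ (Fin d) ×
      (Fin n → EuclideanSpace ℝ (Fin d))) × EuclideanSpace ℝ (Fin m) =>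
      (p.1.1, (toTorus p.1.2, p.2))) hμ.1 hνP
      (by have := continuous_toTorus (n := n) (d := d); exact Continuous.measurable (by fun_prop))
      hhat hGm] at hlim
  set I : ℝ≥0∞ := ∫⁻ p in Ω ×ˢ cellPow n d,
    ∫⁻ z, ENNReal.ofReal (G (p.1, (toTorus p.2, z))) ∂(ν p)
  have hupper : ∀ᶠ h in atTop,
      ∫⁻ x in Ω, ENNReal.ofReal (G (x, (toTorus (microVars (fun k => r k h) x), u h x)))
        ≤ (∫⁻ x in Ω, ENNReal.ofReal (f x (microVars (fun k => r k h) x) (u h x)))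
          + ENNReal.ofReal M * (C₂ * ENNReal.ofReal δ) := by
    filter_upwards [hr1] with h hh
    set B := Ω \ {x | x ∈ X ∧ ∀ k, microVars (fun k => r k h) x k ∈ Y}
    have hBm : MeasurableSet B := by
      refine hΩ.diff (hXc.measurableSet.inter ?_)
      exact measurable_microVars (fun k => r k h) hYnm
    have hBv : volume B ≤ C₂ * ENNReal.ofReal δ := by
      refine (volume_microVars_notMem_le hXv hYv hL (fun k => hr k h)).trans ?_
      rw [hC₂]
      gcongr with k
      all_goals linarith [hh k, hr k h]
    calc _ ≤ ∫⁻ x in Ω, (ENNReal.ofReal (f x (microVars (fun k => r k h) x) (u h x))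
            + B.indicator (fun _ => ENNReal.ofReal M) x) := by
          refine setLIntegral_mono' hΩ fun x hx => ?_
          by_cases hxB : x ∈ B
          · rw [indicator_of_mem hxB]
            exact le_add_left (ENNReal.ofReal_le_ofReal (hGM _).2)
          · obtain ⟨hxX, hxY⟩ : x ∈ X ∧ ∀ k, microVars (fun k => r k h) x k ∈ Y := by
              by_contra h'
              exact hxB ⟨hx, h'⟩
            exact le_add_right (ENNReal.ofReal_le_ofReal (hGle x hxX _ hxY _))
      _ ≤ _ := by
          rw [lintegral_add_right _ (measurable_const.indicator hBm)]
          gcongr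
          rw [lintegral_indicator_const hBm]
          gcongr
          exact (Measure.restrict_apply_le _ _).trans hBv
  have hlower : ∫⁻ p in Ω ×ˢ cellPow n d, ∫⁻ z in Metric.closedBall 0 R,
      ENNReal.ofReal (f p.1 p.2 z) ∂(ν p) ≤ I + ENNReal.ofReal M * (C₁ * ENNReal.ofReal δ) := by
    set B := (Ω ×ˢ cellPow n d) \ (X ×ˢ {y | ∀ k, y k ∈ Y})
    have hD : MeasurableSet (Ω ×ˢ cellPow n d) := hΩ.prod (measurableSet_cellPow n d)
    have hBm : MeasurableSet B := hD.diff (hXc.measurableSet.prod hYnm)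
    calc _ ≤ ∫⁻ p in Ω ×ˢ cellPow n d,
            (∫⁻ z, ENNReal.ofReal (G (p.1, (toTorus p.2, z))) ∂(ν p)
              + B.indicator (fun _ => ENNReal.ofReal M) p) := by
          refine lintegral_mono_ae ?_
          filter_upwards [hνP.2, ae_restrict_mem hD] with p hp hpD
          by_cases hpB : p ∈ B
          · rw [indicator_of_mem hpB]
            refine le_add_left ?_
            calc _ ≤ ∫⁻ _ in Metric.closedBall 0 R, ENNReal.ofReal M ∂(ν p) := by
                  refine setLIntegral_mono' Metric.isClosed_closedBall.measurableSet fun z hz => ?_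
                  refine ENNReal.ofReal_le_ofReal (hfM _ hpD.1 _ hpD.2 z ?_)
                  linarith [mem_closedBall_zero_iff.1 hz]
              _ ≤ ∫⁻ _, ENNReal.ofReal M ∂(ν p) := setLIntegral_le_lintegral _ _
              _ = _ := by simp
          · obtain ⟨hpX, hpY⟩ : p ∈ X ×ˢ {y | ∀ k, y k ∈ Y} := by
              by_contra h'
              exact hpB ⟨hpD, h'⟩
            refine le_add_right ?_
            refine le_trans ?_ (setLIntegral_le_lintegral (Metric.closedBall 0 R) _)
            refine setLIntegral_mono' Metric.isClosed_closedBall.measurableSet fun z hz => ?_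
            rw [hGeq _ hpX _ hpY z (mem_closedBall_zero_iff.1 hz)]
      _ ≤ _ := by
          rw [lintegral_add_right _ (measurable_const.indicator hBm)]
          gcongr
          rw [lintegral_indicator_const hBm]
          gcongr
          exact (Measure.restrict_apply_le _ _).trans (volume_prod_diff_le hXv hYv)
  have hI_le : I ≤ liminf (fun h => ∫⁻ x in Ω, ENNReal.ofReal
      (f x (microVars (fun k => r k h) x) (u h x))) atTop
        + ENNReal.ofReal M * (C₂ * ENNReal.ofReal δ) := by
    -- Moving the finite error to the convergent side leaves only monotonicity of `liminf` to apply.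
    rw [← tsub_le_iff_right]
    have hc : ENNReal.ofReal M * (C₂ * ENNReal.ofReal δ) ≠ ∞ :=
      ENNReal.mul_ne_top ENNReal.ofReal_ne_top (ENNReal.mul_ne_top hC₂' ENNReal.ofReal_ne_top)
    rw [← (ENNReal.Tendsto.sub hlim tendsto_const_nhds (Or.inr hc)).liminf_eq]
    refine liminf_le_liminf ?_
    filter_upwards [hupper] with h hh
    exact tsub_le_iff_right.2 hh
  calc _ ≤ I + ENNReal.ofReal M * (C₁ * ENNReal.ofReal δ) := hlower
    _ ≤ _ := by
        refine (add_le_add_left hI_le _).trans_eq ?_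
        ring

end MultiscaleYoung

/-! ### Removal of the truncation -/

theorem theorem4p2 {n d m : ℕ} (hn : 1 ≤ n) (hd : 1 ≤ d)
    (Ω : Set (EuclideanSpace ℝ (Fin d))) (hΩ : IsOpen Ω) (hΩb : Bornology.IsBounded Ω)
    (ρ : Fin n → ℝ → ℝ) (hρ : MultiscaleYoung.SeparatedScales ρ)
    (ε : ℕ → ℝ) (hε : ∀ h, 0 < ε h) (hε0 : Tendsto ε atTop (𝓝 0))
    (q : ℝ) (hq : 1 ≤ q)
    (u : ℕ → EuclideanSpace ℝ (Fin d) → EuclideanSpace ℝ (Fin m))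
    (hu : ∀ h, MemLp (u h) (ENNReal.ofReal q) (volume.restrict Ω))
    (hub : ∃ C : ℝ, ∀ h,
      eLpNorm (u h) (ENNReal.ofReal q) (volume.restrict Ω) ≤ ENNReal.ofReal C)
    (ν : EuclideanSpace ℝ (Fin d) × (Fin n → EuclideanSpace ℝ (Fin d)) →
      Measure (EuclideanSpace ℝ (Fin m)))
    (hν : MultiscaleYoung.GeneratesMultiscaleYoungMeasure Ω (fun k h => ρ k (ε h)) u ν)
    (f : EuclideanSpace ℝ (Fin d) → (Fin n → EuclideanSpace ℝ (Fin d)) →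
      EuclideanSpace ℝ (Fin m) → ℝ)
    (hf : MultiscaleYoung.IsAdmissibleIntegrand Ω f)
    (c : ℝ) (hc : 0 < c)
    (hfc : ∀ x ∈ Ω, ∀ y ∈ MultiscaleYoung.cellPow n d, ∀ z, f x y z ≤ c * (1 + ‖z‖ ^ q)) :
    (∀ h, AEMeasurable
      (fun x => f x (MultiscaleYoung.microVars (fun k => ρ k (ε h)) x) (u h x))
      (volume.restrict Ω)) ∧
    AEMeasurable (fun p => ∫⁻ z, ENNReal.ofReal (f p.1 p.2 z) ∂(ν p))
      (volume.restrict (Ω ×ˢ MultiscaleYoung.cellPow n d)) ∧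
    ∫⁻ p in Ω ×ˢ MultiscaleYoung.cellPow n d, ∫⁻ z, ENNReal.ofReal (f p.1 p.2 z) ∂(ν p)
      ≤ liminf
          (fun h => ∫⁻ x in Ω, ENNReal.ofReal
            (f x (MultiscaleYoung.microVars (fun k => ρ k (ε h)) x) (u h x))) atTop := by
  have hr : ∀ k h, 0 < ρ k (ε h) := fun k h => hρ.1 k _ (hε h)
  have hε' : Tendsto ε atTop (𝓝[>] 0) :=
    tendsto_nhdsWithin_iff.2 ⟨hε0, Eventually.of_forall hε⟩
  have hr1 : ∀ᶠ h in atTop, ∀ k, ρ k (ε h) ≤ 1 := eventually_all.2 fun k =>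
    ((hρ.2.1 k).comp hε').eventually_le_const zero_lt_one
  have hum : ∀ h, AEMeasurable (u h) (volume.restrict Ω) := fun h => (hu h).1.aemeasurable
  have hΩm := hΩ.measurableSet
  have hD : MeasurableSet (Ω ×ˢ MultiscaleYoung.cellPow n d) :=
    hΩm.prod (MultiscaleYoung.measurableSet_cellPow n d)
  obtain ⟨F, W, hF, hWsub, hFW, hW0, hWr⟩ := hf.exists_measurable hΩb
  have hWae : ∀ᵐ p ∂(volume.restrict (Ω ×ˢ MultiscaleYoung.cellPow n d)), p ∈ W := by
    rw [ae_restrict_iff' hD, ae_iff]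
    refine measure_mono_null (fun p hp => ?_) hW0
    simpa [and_assoc] using hp
  have hball : ∀ A : Set (EuclideanSpace ℝ (Fin m)), MeasurableSet A →
      AEMeasurable (fun p => ∫⁻ z in A, ENNReal.ofReal (f p.1 p.2 z) ∂(ν p))
        (volume.restrict (Ω ×ˢ MultiscaleYoung.cellPow n d)) := by
    intro A hA
    refine (hν.1.aemeasurable_lintegral (hF.indicator (MeasurableSet.univ.prod hA))).congr ?_
    filter_upwards [hWae] with p hp
    rw [← lintegral_indicator hA]
    refine lintegral_congr fun z => ?_
    by_cases hz : z ∈ A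
    · simp [hz, hFW p hp]
    · simp [hz]
  refine ⟨fun h => ?_, by simpa using hball univ MeasurableSet.univ, ?_⟩
  · refine AEMeasurable.congr (f := fun x => (F ((x, MultiscaleYoung.microVars
      (fun k => ρ k (ε h)) x), u h x)).toReal) ?_ ?_
    · exact (hF.comp_aemeasurable ((aemeasurable_id.prodMk
        (MultiscaleYoung.measurable_microVars _).aemeasurable).prodMk (hum h))).ennreal_toReal
    · have hae : ∀ᵐ x ∂(volume.restrict Ω),
          (x, MultiscaleYoung.microVars (fun k => ρ k (ε h)) x) ∈ W := by
        rw [ae_restrict_iff' hΩm, ae_iff]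
        refine measure_mono_null (fun x hx => ?_) (hWr (fun k => ρ k (ε h)) fun k => hr k h)
        simpa using hx
      filter_upwards [hae] with x hx
      rw [hFW _ hx, ENNReal.toReal_ofReal (hf.1 _ (hWsub hx).1 _ (hWsub hx).2 _)]
  · have hsup : ∀ p, ∫⁻ z, ENNReal.ofReal (f p.1 p.2 z) ∂(ν p)
        = ⨆ j : ℕ, ∫⁻ z in Metric.closedBall 0 (j : ℝ), ENNReal.ofReal (f p.1 p.2 z) ∂(ν p) := by
      intro p
      rw [← setLIntegral_iUnion_of_directed, Metric.iUnion_closedBall_nat, Measure.restrict_univ]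
      exact (monotone_nat_of_le_succ fun j =>
        Metric.closedBall_subset_closedBall (by push_cast; linarith)).directed_le
    simp_rw [hsup]
    rw [lintegral_iSup' (fun j => hball _ Metric.isClosed_closedBall.measurableSet)
      (Eventually.of_forall fun p => monotone_nat_of_le_succ fun j =>
        lintegral_mono_set (Metric.closedBall_subset_closedBall (by push_cast; linarith)))]
    -- `M` is the growth bound on the ball of radius `j + 1`, the support radius of the cutoff for
    -- `R = j`.
    refine iSup_le fun j => MultiscaleYoung.lintegral_closedBall_le_liminf hΩm hΩb hr hr1 hum hν hf
      (M := c * (1 + ((j : ℝ) + 1) ^ q)) (by positivity) fun x hx y hy z hz => ?_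
    refine (hfc x hx y hy z).trans ?_
    gcongr
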